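/- Let $G$ be a locally compact Hausdorff abelian group with Pontryagin dual $\widehat G$, let $\mu$ and $\nu$ be (regular) Haar measures on $G$ and $\widehat G$, and let $H\subseteq G$ be a compact open subgroup with annihilator $H^\perp=\{\xi\in\widehat G:\langle h,\xi\rangle=1\ \text{for all }h\in H\}$. Let $$PW_{H^\perp}(G)=\{f\in L^2(G,\mu):\ \widehat f=0\ \ \nu\text{-a.e. outside } H^\perp\},$$ where $f\mapsto\widehat f$ is the $L^2$ Fourier transform, that is, the continuous extension to $L^2(G)$ of $\widehat f(\xi)=\int_G f(x)\overline{\langle x,\xi\rangle}\,d\mu(x)$, $f\in L^1(G)\cap L^2(G)$. Then every element of $PW_{H^\perp}(G)$ has exactly one continuous representative. Identify the elements of $PW_{H^\perp}(G)$ with their continuous representatives. Then a set $\Upsilon\subseteq G$ is a uniqueness set for $PW_{H^\perp}(G)$ (that is, every $f\in PW_{H^\perp}(G)$ with $f(\upsilon)=0$ for all $\upsilon\in\Upsilon$ is $0$) if and only if $\Upsilon$ contains a section of $G/H$ (that is, a measurable set containing exactly one element of each coset of $H$ in $G$). -/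

import Mathlib

open MeasureTheory Filter Topology
open scoped ComplexConjugate ENNReal

namespace LCA

variable {G : Type*} [CommGroup G] [TopologicalSpace G]

/-- The annihilator `H^⊥` of a subgroup `H` of `G` in the Pontryagin dual of `G`
(groups are written multiplicatively). -/
def annihilator (H : Subgroup G) : Subgroup (PontryaginDual G) where
  carrier := {ξ | ∀ h ∈ H, ξ h = 1}
  one_mem' := fun h _ => PontryaginDual.one_apply h
  mul_mem' := by
    intro ξ η hξ hη h hh
    change ξ h * η h = 1
    rw [hξ h hh, hη h hh, one_mul]
  inv_mem' := by
    intro ξ hξ h hh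
    change (ξ h)⁻¹ = 1
    rw [hξ h hh, inv_one]

/-- A section of `G ⧸ H`: a measurable set containing exactly one element of each coset. -/
def IsSection [MeasurableSpace G] (H : Subgroup G) (C : Set G) : Prop :=
  MeasurableSet C ∧ ∀ q : G ⧸ H, ∃! c : G, c ∈ C ∧ (QuotientGroup.mk c : G ⧸ H) = q

/-- The Fourier transform of an integrable function,
`ξ ↦ ∫ f(x) * conj ⟨x, ξ⟩ dμ(x)`. -/
noncomputable def fourierL1 [MeasurableSpace G] (μ : Measure G) (f : G → ℂ)
    (ξ : PontryaginDual G) : ℂ :=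
  ∫ x, f x * conj (ξ x : ℂ) ∂μ

/-- `F ∈ L²` of the dual group is the Fourier(-Plancherel) transform of `f ∈ L²(G)`: the
extension by continuity of the Fourier transform from `L¹ ∩ L²` to `L²`, i.e. there are
`g n ∈ L¹ ∩ L²` such that `g n → f` and the Fourier transforms of the `g n` tend to `F`,
both in `L²`. This does not depend on the normalization of the Haar measures. -/
def IsFourierL2 [MeasurableSpace G] [MeasurableSpace (PontryaginDual G)]
    (μ : Measure G) (ν : Measure (PontryaginDual G)) (f : Lp ℂ 2 μ) (F : Lp ℂ 2 ν) : Prop :=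
  ∃ g : ℕ → G → ℂ, (∀ n, Integrable (g n) μ ∧ MemLp (g n) 2 μ) ∧
    Tendsto (fun n => eLpNorm (fun x => g n x - f x) 2 μ) atTop (𝓝 0) ∧
    Tendsto (fun n => eLpNorm (fun ξ => fourierL1 μ (g n) ξ - F ξ) 2 ν) atTop (𝓝 0)

/-- The Paley-Wiener space of `Ω`: the elements of `L²(G)` whose Fourier transform is
supported in `Ω`, i.e. vanishes almost everywhere off `Ω`. -/
def paleyWiener [MeasurableSpace G] [MeasurableSpace (PontryaginDual G)]
    (μ : Measure G) (ν : Measure (PontryaginDual G)) (Ω : Set (PontryaginDual G)) :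
    Set (Lp ℂ 2 μ) :=
  {f | ∃ F : Lp ℂ 2 ν, IsFourierL2 μ ν f F ∧ ∀ᵐ ξ ∂ν, ξ ∉ Ω → F ξ = 0}

/-- The elements of the Paley-Wiener space as functions on `G`, that is, the continuous
representatives of its elements. -/
def paleyWienerFun [MeasurableSpace G] [MeasurableSpace (PontryaginDual G)]
    (μ : Measure G) (ν : Measure (PontryaginDual G)) (Ω : Set (PontryaginDual G)) :
    Set (G → ℂ) :=
  {g | Continuous g ∧ ∃ f ∈ paleyWiener μ ν Ω, g =ᵐ[μ] f}

/-- `Υ` is a uniqueness set for a set `X` of functions: a member of `X` that vanishes on `Υ`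
is zero. -/
def IsUniquenessSet {α : Type*} (X : Set (α → ℂ)) (Υ : Set α) : Prop :=
  ∀ f ∈ X, (∀ υ ∈ Υ, f υ = 0) → f = 0

end LCA

/-!
Write `K = H^⊥`. Since `H` is compact and open, so is `K`, and the theorem follows from one fact: an
element of the Paley-Wiener space of `K` agrees almost everywhere with its average over each coset
of `H`, so its continuous representative is exactly the function of these averages, which is
constant on cosets (`LCA.average_ae_eq_of_mem_paleyWiener`). Conversely, the indicator functions of
the cosets of `H` lie in the space (`LCA.indicator_cosetSet_mem_paleyWienerFun`). Hence `Υ` is a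
uniqueness set if and only if it meets every coset; and a choice of one point in each coset is
automatically closed, because the cosets are open (`LCA.isSection_range`).

To see that `f` is constant on cosets without the Plancherel theorem, let `ξ₀ ∉ K`. For integrable
`g`, Fubini gives a multiplication formula (`LCA.setIntegral_cosetSet_mul_fourierL1`): for `y ∈ G`,
`∫ ξ in ξ₀K, ξ(y) ĝ(ξ) = ν(K) ξ₀(y) ∫ x in yH, g(x) conj ξ₀(x)`. Here the kernel
`∫ ξ in ξ₀K, ξ(y) conj ξ(x)` is `0` unless `x ∈ yH`, because the characters in `K` separate the
points of `G ⧸ H`. Both sides are continuous in `L²`, so the formula persists for the pair `f, f̂`.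
As `f̂` vanishes on `ξ₀K`, all integrals of `f conj ξ₀` over cosets of `H` vanish
(`LCA.setIntegral_mul_conj_eq_zero_of_mem_paleyWiener`). Thus `f` minus its average on a coset is
orthogonal to every character there, and so vanishes, because characters are complete on compact
sets (`ae_eq_zero_of_forall_setIntegral_mul_conj_eq_zero`). There may be uncountably many cosets,
but a square integrable function lives on countably many of them
(`exists_countable_cosets_of_memLp`), which lets one assemble the null sets.

Completeness is the Stone-Weierstrass theorem together with the existence of enough characters
(`exists_pontryaginDual_apply_ne_one`), proved as follows. Averaging the regular representation on
`L²(G)` over a small compact symmetric neighbourhood of `1` gives a self-adjoint operator `A`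
commuting with the translations `U x`, such that `x ↦ U x * A` is norm continuous and
`U x₀ * A ≠ A` for a prescribed `x₀ ≠ 1`. The translations and `A` generate a commutative
C⋆-algebra. By Gelfand duality it has a multiplicative functional `φ` with `φ (U x₀ * A) ≠ φ A`, and
then `x ↦ φ (U x)` is a character, continuous because it equals `φ (U x * A) / φ A`.
-/

/-! ### Characters from commuting operators in a C⋆-algebra -/

/-- A commuting family of unitaries `u x`, smoothed by a commuting self-adjoint `a` that makes
`x ↦ u x * a` norm continuous, yields a character of `G` that is nontrivial at every prescribed `x₀`
with `u x₀ * a ≠ a`: evaluate the commutative C⋆-algebra they generate at a Gelfand character. -/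
theorem exists_pontryaginDual_apply_ne_one_of_unitary {G B : Type*} [CommGroup G]
    [TopologicalSpace G] [CStarAlgebra B] (u : G →* unitary B) (a : B) (ha : IsSelfAdjoint a)
    (hcomm : ∀ x, Commute (u x : B) a) (hcont : Continuous fun x => (u x : B) * a) {x₀ : G}
    (hx₀ : (u x₀ : B) * a ≠ a) : ∃ ξ : PontryaginDual G, ξ x₀ ≠ 1 := by
  set s : Set B := insert a (Set.range fun x => (u x : B)) with hs
  have hstar : ∀ x, star (u x : B) = u x⁻¹ := fun x => by
    rw [map_inv]; rfl
  have huu : ∀ x y, (u x : B) * u y = u y * u x := fun x y => by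
    have := congrArg (fun z : unitary B => (z : B)) (show u x * u y = u y * u x by
      rw [← map_mul, ← map_mul, mul_comm])
    simpa using this
  have hs1 : ∀ b ∈ s, ∀ c ∈ s, b * c = c * b := by
    rintro b (rfl | ⟨x, rfl⟩) c (rfl | ⟨y, rfl⟩)
    · rfl
    · exact (hcomm y).symm.eq
    · exact (hcomm x).eq
    · exact huu x y
  have hs2 : ∀ b ∈ s, star b ∈ s := by
    rintro b (rfl | ⟨x, rfl⟩)
    · rw [ha.star_eq]; exact Set.mem_insert _ _
    · exact Or.inr ⟨x⁻¹, (hstar x).symm⟩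
  have hS0 := StarAlgebra.isMulCommutative_adjoin ℂ hs1 fun b hb c hc => hs1 b hb _ (hs2 c hc)
  set S := (StarAlgebra.adjoin ℂ s).topologicalClosure with hS
  have hsub : ∀ b ∈ s, b ∈ S := fun b hb =>
    StarSubalgebra.le_topologicalClosure _ (StarAlgebra.subset_adjoin ℂ s hb)
  have hclosed : IsClosed (S : Set B) := StarSubalgebra.isClosed_topologicalClosure _
  let instC : CStarAlgebra S := StarSubalgebra.cstarAlgebra S (h_closed := hclosed)
  let instCC : CommCStarAlgebra S :=
    { instC with
      mul_comm := (StarSubalgebra.commRingTopologicalClosure _ hS0.is_comm.comm).mul_comm }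
  let a' : S := ⟨a, hsub a (Set.mem_insert _ _)⟩
  let v : G → S := fun x => ⟨u x, hsub _ (Or.inr ⟨x, rfl⟩)⟩
  have hv1 : v 1 = 1 := Subtype.ext (by simp [v])
  have hvm : ∀ x y, v (x * y) = v x * v y := fun x y => Subtype.ext (by simp [v])
  have hvs : ∀ x, star (v x) * v x = 1 := fun x => Subtype.ext (by simp [v])
  have hne : v x₀ * a' - a' ≠ 0 := fun h => hx₀ (congrArg Subtype.val (sub_eq_zero.1 h))
  -- The Gelfand transform is injective.
  obtain ⟨φ, hφ⟩ : ∃ φ : WeakDual.characterSpace ℂ S, φ (v x₀ * a' - a') ≠ 0 := by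
    by_contra! h
    refine hne ((gelfandTransform_isometry S).injective ?_)
    ext φ
    simpa using h φ
  -- `φ (v x₀ * a' - a')` is a multiple of `φ a'`, so `φ a' ≠ 0`, and dividing by it turns the norm
  -- continuity of `x ↦ u x * a` into continuity of `x ↦ φ (v x)`.
  have hφa : φ a' ≠ 0 := fun h => hφ (by rw [map_sub, map_mul, h]; simp)
  have hnorm : ∀ x, ‖φ (v x)‖ = 1 := fun x => by
    have h := congrArg φ (hvs x)
    rw [map_mul, map_star, map_one] at h
    have h2 := congrArg norm h
    rw [norm_mul, norm_star, norm_one] at h2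
    nlinarith [norm_nonneg (φ (v x))]
  let χ : G →* Circle :=
    { toFun := fun x => ⟨φ (v x), mem_sphere_zero_iff_norm.2 (hnorm x)⟩
      map_one' := Subtype.ext (show φ (v 1) = 1 by rw [hv1, map_one])
      map_mul' := fun x y => Subtype.ext
        (show φ (v (x * y)) = φ (v x) * φ (v y) by rw [hvm, map_mul]) }
  have hχ : Continuous χ := by
    refine continuous_induced_rng.2 ?_
    have : (fun x => ((χ x : Circle) : ℂ)) = fun x => φ (v x * a') / φ a' := by
      ext x
      rw [map_mul, mul_div_cancel_right₀ _ hφa]; rfl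
    refine Eq.mpr (congrArg Continuous this) ?_
    exact ((map_continuous φ).comp (Continuous.subtype_mk hcont _)).div_const _
  refine ⟨⟨χ, hχ⟩, fun h => hφ ?_⟩
  have h' : φ (v x₀) = 1 := congrArg (fun z : Circle => (z : ℂ)) h
  rw [map_sub, map_mul, h', one_mul, sub_self]

/-! ### Characters separate the points of a locally compact abelian group -/

theorem norm_setIntegral_sub_setIntegral_le {α F : Type*} [MeasurableSpace α]
    [NormedAddCommGroup F] [NormedSpace ℝ F] {μ : Measure α} {s t : Set α} (hs : MeasurableSet s)
    (ht : MeasurableSet t) (hst : μ (symmDiff s t) ≠ ∞) {g : α → F}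
    (hgs : IntegrableOn g s μ) (hgt : IntegrableOn g t μ) {C : ℝ} (hC : ∀ x, ‖g x‖ ≤ C) :
    ‖∫ x in s, g x ∂μ - ∫ x in t, g x ∂μ‖ ≤ C * μ.real (symmDiff s t) := by
  have h1 : μ (s \ t) < ∞ := (measure_mono le_sup_left).trans_lt hst.lt_top
  have h2 : μ (t \ s) < ∞ := (measure_mono le_sup_right).trans_lt hst.lt_top
  have h : ∫ x in s, g x ∂μ - ∫ x in t, g x ∂μ =
      ∫ x in s \ t, g x ∂μ - ∫ x in t \ s, g x ∂μ := by
    rw [← integral_inter_add_sdiff ht hgs, ← integral_inter_add_sdiff hs hgt, Set.inter_comm t s]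
    abel
  have h3 : μ.real (symmDiff s t) = μ.real (s \ t) + μ.real (t \ s) :=
    measureReal_union disjoint_sdiff_sdiff (ht.diff hs) h1.ne h2.ne
  rw [h, h3, mul_add]
  exact (norm_sub_le _ _).trans (add_le_add
    (norm_setIntegral_le_of_norm_le_const h1 fun x _ => hC x)
    (norm_setIntegral_le_of_norm_le_const h2 fun x _ => hC x))

section Rep

variable {G E : Type*} [CommGroup G] [TopologicalSpace G] [T2Space G] [MeasurableSpace G]
  [BorelSpace G] [NormedAddCommGroup E] [InnerProductSpace ℂ E]

/-- The operator `f ↦ ∫ y in V, ρ y f ∂μ`, for a strongly continuous unitary representation `ρ` and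
a compact set `V`. -/
noncomputable def integratedRep (μ : Measure G) [IsFiniteMeasureOnCompacts μ]
    (ρ : G →* (E ≃ₗᵢ[ℂ] E)) (hρ : ∀ f, Continuous fun x => ρ x f) {V : Set G}
    (hV : IsCompact V) : E →L[ℂ] E :=
  LinearMap.mkContinuous
    { toFun := fun f => ∫ y in V, ρ y f ∂μ
      map_add' := fun f g => by
        simp only [map_add]
        exact integral_add ((hρ f).continuousOn.integrableOn_compact hV)
          ((hρ g).continuousOn.integrableOn_compact hV)
      map_smul' := fun c f => by
        simp only [map_smul, RingHom.id_apply]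
        exact integral_smul c _ }
    (μ.real V) fun f => by
      rw [mul_comm]
      exact norm_setIntegral_le_of_norm_le_const hV.measure_lt_top
        fun y _ => ((ρ y).norm_map f).le

variable (μ : Measure G) [IsFiniteMeasureOnCompacts μ]
    (ρ : G →* (E ≃ₗᵢ[ℂ] E)) (hρ : ∀ f, Continuous fun x => ρ x f) {V : Set G}
    (hV : IsCompact V)

theorem integratedRep_apply (f : E) : integratedRep μ ρ hρ hV f = ∫ y in V, ρ y f ∂μ := rfl

variable [CompleteSpace E]

theorem rep_integratedRep (x : G) (f : E) :
    ρ x (integratedRep μ ρ hρ hV f) = ∫ y in V, ρ (x * y) f ∂μ := by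
  rw [integratedRep_apply]
  have := (ρ x).toContinuousLinearEquiv.toContinuousLinearMap.integral_comp_comm
    ((hρ f).continuousOn.integrableOn_compact (μ := μ) hV)
  simp_rw [map_mul]
  exact this.symm

theorem integratedRep_rep (x : G) (f : E) :
    integratedRep μ ρ hρ hV (ρ x f) = ρ x (integratedRep μ ρ hρ hV f) := by
  rw [rep_integratedRep, integratedRep_apply]
  simp_rw [mul_comm x, map_mul]
  rfl

variable [IsTopologicalGroup G]

/-- The adjoint of `ρ y` is `ρ y⁻¹`, and the Haar measure of an abelian group is invariant under
inversion. -/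
theorem integratedRep_isSelfAdjoint [μ.IsInvInvariant] (hVinv : V⁻¹ = V) :
    IsSelfAdjoint (integratedRep μ ρ hρ hV) := by
  rw [ContinuousLinearMap.isSelfAdjoint_iff_isSymmetric]
  intro f g
  have hinv : ∀ y, inner ℂ (ρ y f) g = inner ℂ f (ρ y⁻¹ g) := fun y => by
    have h : ρ y (ρ y⁻¹ g) = g := by
      change (ρ y * ρ y⁻¹) g = g
      rw [← map_mul, mul_inv_cancel, map_one]
      rfl
    rw [← (ρ y).inner_map_map f, h]
  have hint : ∀ f, IntegrableOn (fun y => ρ y f) V μ := fun f =>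
    (hρ f).continuousOn.integrableOn_compact hV
  simp only [ContinuousLinearMap.coe_coe, integratedRep_apply]
  rw [← integral_inner (hint g), ← inner_conj_symm, ← integral_inner (hint f), ← integral_conj]
  simp_rw [inner_conj_symm, hinv]
  conv_lhs => rw [← hVinv]
  exact (Measure.measurePreserving_inv μ).setIntegral_preimage_emb
    (MeasurableEquiv.inv G).measurableEmbedding (fun y => inner ℂ f (ρ y g)) V

end Rep

section RepHaar

variable {G E : Type*} [CommGroup G] [TopologicalSpace G] [IsTopologicalGroup G] [T2Space G]
  [LocallyCompactSpace G] [MeasurableSpace G] [BorelSpace G]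
  [NormedAddCommGroup E] [InnerProductSpace ℂ E] [CompleteSpace E]
  (μ : Measure G) [μ.IsHaarMeasure] (ρ : G →* (E ≃ₗᵢ[ℂ] E))
  (hρ : ∀ f, Continuous fun x => ρ x f) {V : Set G} (hV : IsCompact V)

/-- A strongly continuous representation becomes norm continuous after smoothing: `ρ x` composed
with the integral over `V` is the integral over `x V`, and `x ↦ x V` is continuous in measure. -/
theorem continuous_rep_mul_integratedRep [μ.Regular] :
    Continuous fun x =>
      ((ρ x).toContinuousLinearEquiv : E →L[ℂ] E) * integratedRep μ ρ hρ hV := by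
  have key : ∀ x f, ρ x (integratedRep μ ρ hρ hV f) =
      ∫ y in (fun y => x⁻¹ * y) ⁻¹' V, ρ y f ∂μ := fun x f => by
    rw [rep_integratedRep]
    have := (measurePreserving_mul_left μ x⁻¹).setIntegral_preimage_emb
      (MeasurableEquiv.mulLeft x⁻¹).measurableEmbedding (fun y => ρ (x * y) f) V
    rw [← this]
    simp
  have hcpt : ∀ x : G, IsCompact ((fun y => x⁻¹ * y) ⁻¹' V) := fun x =>
    (Homeomorph.mulLeft x⁻¹).isClosedEmbedding.isCompact_preimage hV
  have hfin : ∀ x z : G,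
      μ (symmDiff ((fun y => x⁻¹ * y) ⁻¹' V) ((fun y => z⁻¹ * y) ⁻¹' V)) ≠ ∞ := fun x z =>
    ((measure_mono Set.symmDiff_subset_union).trans_lt
      ((hcpt x).union (hcpt z)).measure_lt_top).ne
  rw [continuous_iff_continuousAt]
  intro z
  let c : C(G, C(G, G)) := (ContinuousMap.mk (fun a : G × G => a.1⁻¹ * a.2)
    (by fun_prop)).curry
  have hlim := tendsto_measure_symmDiff_preimage_nhds_zero (μ := μ) (ν := μ)
    (c.continuous.tendsto z) (.of_forall fun x => measurePreserving_mul_left μ x⁻¹)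
    (measurePreserving_mul_left μ z⁻¹) hV.measurableSet.nullMeasurableSet hV.measure_lt_top.ne
  have hlim' := (ENNReal.tendsto_toReal ENNReal.zero_ne_top).comp hlim
  rw [ENNReal.toReal_zero] at hlim'
  rw [ContinuousAt, tendsto_iff_norm_sub_tendsto_zero]
  refine squeeze_zero (fun _ => norm_nonneg _) (fun x => ?_) hlim'
  refine ContinuousLinearMap.opNorm_le_bound _ ENNReal.toReal_nonneg fun f => ?_
  have := norm_setIntegral_sub_setIntegral_le (hcpt x).measurableSet (hcpt z).measurableSet
    (hfin x z) ((hρ f).continuousOn.integrableOn_compact (hcpt x))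
    ((hρ f).continuousOn.integrableOn_compact (hcpt z)) (fun y => ((ρ y).norm_map f).le)
  rw [← key, ← key, mul_comm] at this
  exact this

/-- If `ρ x₀` moves `f`, it also moves the mean of `ρ y f` over `y` in a small symmetric
neighbourhood `V` of `1`, because this mean is close to `f`. -/
theorem exists_integratedRep_ne {x₀ : G} {f : E}
    (hf : ρ x₀ f ≠ f) :
    ∃ (V : Set G) (hV : IsCompact V), V⁻¹ = V ∧
      ρ x₀ (integratedRep μ ρ hρ hV f) ≠ integratedRep μ ρ hρ hV f := by
  set ε := ‖ρ x₀ f - f‖ / 3 with hε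
  have hε0 : 0 < ε := div_pos (norm_pos_iff.2 (sub_ne_zero.2 hf)) three_pos
  have hnhds : {y | ‖ρ y f - f‖ < ε} ∈ 𝓝 (1 : G) := by
    refine ((hρ f).sub continuous_const).norm.continuousAt.eventually_lt
      continuousAt_const ?_
    simpa using hε0
  obtain ⟨K, hK, hKsub, hKc⟩ := local_compact_nhds hnhds
  refine ⟨K ∩ K⁻¹, hKc.inter hKc.inv, by rw [Set.inter_inv, inv_inv, Set.inter_comm], fun h => ?_⟩
  set V := K ∩ K⁻¹ with hV
  have hVc : IsCompact V := hKc.inter hKc.inv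
  have hVn : V ∈ 𝓝 (1 : G) := inter_mem hK (inv_mem_nhds_one G hK)
  have hm : 0 < μ.real V :=
    ENNReal.toReal_pos (Measure.measure_pos_of_mem_nhds μ hVn).ne' hVc.measure_lt_top.ne
  have hA : ‖integratedRep μ ρ hρ hVc f - μ.real V • f‖ ≤ ε * μ.real V := by
    rw [integratedRep_apply, ← setIntegral_const,
      ← integral_sub ((hρ f).continuousOn.integrableOn_compact hVc)
        (integrableOn_const hVc.measure_lt_top.ne)]
    exact norm_setIntegral_le_of_norm_le_const hVc.measure_lt_top fun y hy => (hKsub hy.1).le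
  have h1 : ‖ρ x₀ (μ.real V • f) - μ.real V • f‖ ≤ 2 * (ε * μ.real V) := by
    have h2 : ρ x₀ (μ.real V • f) - μ.real V • f =
        (integratedRep μ ρ hρ hVc f - μ.real V • f) -
          ρ x₀ (integratedRep μ ρ hρ hVc f - μ.real V • f) := by
      rw [map_sub, h]; abel
    rw [h2, two_mul]
    refine (norm_sub_le _ _).trans (add_le_add hA ?_)
    rwa [(ρ x₀).norm_map]
  have h3 : ρ x₀ (μ.real V • f) = μ.real V • ρ x₀ f :=
    (ρ x₀).toContinuousLinearEquiv.toContinuousLinearMap.map_smul_of_tower _ _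
  rw [h3, ← smul_sub, norm_smul, Real.norm_of_nonneg hm.le] at h1
  have : ‖ρ x₀ f - f‖ = 3 * ε := by rw [hε]; ring
  rw [this] at h1
  nlinarith [mul_pos hm hε0]

end RepHaar

section Regular

variable {G : Type*} [CommGroup G] [TopologicalSpace G] [IsTopologicalGroup G]
  [LocallyCompactSpace G] [MeasurableSpace G] [BorelSpace G]

/-- The regular representation of `G` on `L²(G)`, `(x, f) ↦ f (x * ·)`. -/
noncomputable def regularRep (μ : Measure G) [μ.IsMulLeftInvariant] :
    G →* (Lp ℂ 2 μ ≃ₗᵢ[ℂ] Lp ℂ 2 μ) where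
  toFun x :=
    { toFun := fun f => DomMulAct.mk x • f
      invFun := fun f => DomMulAct.mk x⁻¹ • f
      map_add' := fun f g => smul_add _ f g
      map_smul' := fun c f => smul_comm _ c f
      left_inv := fun f => by simp [smul_smul]
      right_inv := fun f => by simp [smul_smul]
      norm_map' := fun f => DomMulAct.norm_smul_Lp _ f }
  map_one' := by ext1 f; exact one_smul Gᵈᵐᵃ f
  map_mul' x y := by
    ext1 f
    change DomMulAct.mk (x * y) • f = DomMulAct.mk x • DomMulAct.mk y • f
    rw [smul_smul, ← DomMulAct.mk_mul, mul_comm]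

theorem continuous_regularRep (μ : Measure G) [μ.IsHaarMeasure] [μ.Regular] (f : Lp ℂ 2 μ) :
    Continuous fun x => regularRep μ x f := by
  have : Fact ((2 : ℝ≥0∞) ≠ ∞) := ⟨by simp⟩
  exact (DomMulAct.continuous_mk).smul continuous_const

/-- The indicator function of a small neighbourhood of `1` is disjoint from its translate by `x₀`.
-/
theorem exists_regularRep_ne [T2Space G] (μ : Measure G) [μ.IsHaarMeasure] {x₀ : G} (hx₀ : x₀ ≠ 1) :
    ∃ f, regularRep μ x₀ f ≠ f := by
  obtain ⟨V, hV, hV'⟩ := exists_nhds_split_inv (isOpen_ne.mem_nhds (Ne.symm hx₀))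
  obtain ⟨K, hK, hKV, hKc⟩ := local_compact_nhds hV
  refine ⟨indicatorConstLp 2 hKc.measurableSet hKc.measure_lt_top.ne 1, fun h => ?_⟩
  have hpre : MeasurableSet ((x₀ • ·) ⁻¹' K) :=
    hKc.measurableSet.preimage (measurable_const_smul x₀)
  have hfin : μ ((x₀ • ·) ⁻¹' K) ≠ ∞ :=
    (measure_preimage_smul μ x₀ K).trans_ne hKc.measure_lt_top.ne
  have h' : indicatorConstLp 2 hpre hfin (1 : ℂ) =
    indicatorConstLp 2 hKc.measurableSet hKc.measure_lt_top.ne 1 := h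
  have h1 := indicatorConstLp_coeFn (p := 2) (hs := hpre) (hμs := hfin) (c := (1 : ℂ))
  rw [h'] at h1
  have hae := h1.symm.trans indicatorConstLp_coeFn
  refine (Measure.measure_pos_of_mem_nhds μ hK).ne' (measure_mono_null (fun a ha => ?_) hae)
  simp only [Set.mem_compl_iff, Set.mem_ofPred_eq]
  intro h2
  have h3 : x₀ • a ∉ K := fun h3 => hV' _ (hKV h3) _ (hKV ha) (by simp)
  rw [Set.indicator_of_mem ha, Set.indicator_of_notMem (by exact h3)] at h2
  exact zero_ne_one h2

end Regular

/-- **Gelfand-Raikov theorem** for abelian groups: the characters of a locally compact Hausdorff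
abelian group separate its points. -/
theorem exists_pontryaginDual_apply_ne_one {G : Type*} [CommGroup G] [TopologicalSpace G]
    [IsTopologicalGroup G] [LocallyCompactSpace G] [T2Space G] {x : G} (hx : x ≠ 1) :
    ∃ ξ : PontryaginDual G, ξ x ≠ 1 := by
  borelize G
  let μ : Measure G := Measure.haar
  obtain ⟨f, hf⟩ := exists_regularRep_ne μ hx
  have hρ := continuous_regularRep μ
  obtain ⟨V, hV, hVinv, hne⟩ := exists_integratedRep_ne μ (regularRep μ) hρ hf
  refine exists_pontryaginDual_apply_ne_one_of_unitary
    (Unitary.linearIsometryEquiv.symm.toMonoidHom.comp (regularRep μ))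
    (integratedRep μ (regularRep μ) hρ hV)
    (integratedRep_isSelfAdjoint μ (regularRep μ) hρ hV hVinv) (fun y => ?_)
    (continuous_rep_mul_integratedRep μ (regularRep μ) hρ hV) (x₀ := x) fun h => hne ?_
  · ext1 g
    exact (integratedRep_rep μ (regularRep μ) hρ hV y g).symm
  · exact congrArg (fun T : Lp ℂ 2 μ →L[ℂ] Lp ℂ 2 μ => T f) h

/-! ### Completeness of the characters on compact sets -/

section Trig

variable {G : Type*} [CommGroup G] [TopologicalSpace G]

theorem continuous_coe_character (ξ : PontryaginDual G) : Continuous fun x => (ξ x : ℂ) :=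
  continuous_subtype_val.comp (map_continuous ξ)

/-- A character of `G` as a bounded continuous function. -/
noncomputable def characterBCF (ξ : PontryaginDual G) : BoundedContinuousFunction G ℂ :=
  BoundedContinuousFunction.ofNormedAddCommGroup (fun x => (ξ x : ℂ))
    (continuous_coe_character ξ) 1 fun _ => (Circle.norm_coe _).le

/-- Restriction of bounded continuous functions to a subset, as a linear map. -/
noncomputable def restrictBCF (S : Set G) : BoundedContinuousFunction G ℂ →ₗ[ℂ] C(S, ℂ) where
  toFun φ := φ.toContinuousMap.restrict S
  map_add' _ _ := rfl
  map_smul' _ _ := rfl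

/-- The star subalgebra of `C(S, ℂ)` of trigonometric polynomials, that is, generated by the
restrictions of characters of `G`. -/
noncomputable def trigSubalgebra (S : Set G) : StarSubalgebra ℂ C(S, ℂ) where
  toSubalgebra := Algebra.adjoin ℂ (Set.range fun ξ => restrictBCF S (characterBCF ξ))
  star_mem' := by
    change Algebra.adjoin ℂ (Set.range fun ξ => restrictBCF S (characterBCF ξ)) ≤
      star (Algebra.adjoin ℂ (Set.range fun ξ => restrictBCF S (characterBCF ξ)))
    refine Algebra.adjoin_le ?_
    rintro - ⟨ξ, rfl⟩
    refine Algebra.subset_adjoin ⟨ξ⁻¹, ?_⟩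
    ext x
    exact Circle.coe_inv_eq_conj (ξ x)

/-- Products of characters are characters, so trigonometric polynomials are linear combinations of
characters. -/
theorem trigSubalgebra_coe (S : Set G) :
    Subalgebra.toSubmodule (trigSubalgebra S).toSubalgebra =
      (Submodule.span ℂ (Set.range characterBCF)).map (restrictBCF S) := by
  rw [Submodule.map_span, ← Set.range_comp]
  refine Algebra.adjoin_eq_span_of_subset (R := ℂ) ?_
  refine Set.Subset.trans ?_ Submodule.subset_span
  intro x hx
  refine Submonoid.closure_induction (fun _ => id) ⟨1, ?_⟩ ?_ hx
  · ext x
    exact Circle.coe_one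
  · rintro - - - - ⟨ξ, rfl⟩ ⟨η, rfl⟩
    refine ⟨ξ * η, ?_⟩
    ext x
    exact Circle.coe_mul (ξ x) (η x)

variable [IsTopologicalGroup G] [LocallyCompactSpace G] [T2Space G]

theorem trigSubalgebra_separatesPoints (S : Set G) :
    (trigSubalgebra S).toSubalgebra.SeparatesPoints := by
  intro x y hxy
  have hne : (x : G) * (y : G)⁻¹ ≠ 1 := fun h => hxy (Subtype.ext (mul_inv_eq_one.1 h))
  obtain ⟨ξ, hξ⟩ := exists_pontryaginDual_apply_ne_one hne
  refine ⟨_, ⟨restrictBCF S (characterBCF ξ), Algebra.subset_adjoin ⟨ξ, rfl⟩, rfl⟩, fun h => hξ ?_⟩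
  rw [map_mul, map_inv, mul_inv_eq_one]
  exact Circle.ext h

/-- Stone-Weierstrass: trigonometric polynomials approximate continuous functions uniformly on
compact sets. -/
theorem exists_trig_norm_sub_le {S : Set G} (hS : IsCompact S)
    (φ : BoundedContinuousFunction G ℂ) {ε : ℝ} (hε : 0 < ε) :
    ∃ p ∈ Submodule.span ℂ (Set.range (characterBCF (G := G))), ∀ x ∈ S, ‖φ x - p x‖ ≤ ε := by
  have : CompactSpace S := isCompact_iff_compactSpace.1 hS
  have h := ContinuousMap.starSubalgebra_topologicalClosure_eq_top_of_separatesPoints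
    (trigSubalgebra S) (trigSubalgebra_separatesPoints S)
  have hφ : restrictBCF S φ ∈ closure (trigSubalgebra S : Set C(S, ℂ)) := by
    rw [← StarSubalgebra.topologicalClosure_coe, h]
    trivial
  obtain ⟨q, hq, hqφ⟩ := Metric.mem_closure_iff.1 hφ ε hε
  have hq' : q ∈ Subalgebra.toSubmodule (trigSubalgebra S).toSubalgebra := hq
  rw [trigSubalgebra_coe] at hq'
  obtain ⟨p, hp, rfl⟩ := hq'
  refine ⟨p, hp, fun x hx => ?_⟩
  rw [dist_eq_norm] at hqφ
  exact ((restrictBCF S φ - restrictBCF S p).norm_coe_le_norm ⟨x, hx⟩).trans hqφ.le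

variable [NormalSpace G] [MeasurableSpace G] [BorelSpace G] (μ : Measure G) [μ.IsHaarMeasure]
  [μ.Regular]

theorem topologicalClosure_span_characters_eq_top {S : Set G} (hS : IsCompact S)
    [IsFiniteMeasure (μ.restrict S)] :
    ((Submodule.span ℂ (Set.range (characterBCF (G := G)))).map
      (BoundedContinuousFunction.toLp 2 (μ.restrict S) ℂ).toLinearMap).topologicalClosure = ⊤ := by
  have : (μ.restrict S).Regular := Measure.Regular.restrict_of_measure_ne_top hS.measure_lt_top.ne
  rw [← SetLike.coe_set_eq, Submodule.topologicalClosure_coe, Submodule.top_coe,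
    ← dense_iff_closure_eq]
  refine Dense.of_closure ((BoundedContinuousFunction.toLp_denseRange (p := 2) ℂ (μ.restrict S) ℂ
    (by simp)).mono ?_)
  rintro - ⟨φ, rfl⟩
  rw [Metric.mem_closure_iff]
  intro ε hε
  set c : ℝ := (μ.restrict S).real Set.univ ^ (2 : ℝ≥0∞).toReal⁻¹ with hc
  have hc0 : 0 ≤ c := by positivity
  obtain ⟨p, hp, hpφ⟩ := exists_trig_norm_sub_le hS φ (ε := ε / (c + 1)) (by positivity)
  refine ⟨_, ⟨p, hp, rfl⟩, ?_⟩
  rw [dist_eq_norm]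
  refine lt_of_le_of_lt (b := c * (ε / (c + 1))) ?_ ?_
  · change ‖BoundedContinuousFunction.toLp 2 (μ.restrict S) ℂ φ -
      BoundedContinuousFunction.toLp 2 (μ.restrict S) ℂ p‖ ≤ _
    rw [← map_sub]
    refine Lp.norm_le_of_ae_bound (by positivity) ?_
    filter_upwards [BoundedContinuousFunction.coeFn_toLp (p := 2) (μ.restrict S) ℂ (φ - p),
      ae_restrict_mem hS.measurableSet] with x hx hxS
    rw [hx]
    exact hpφ x hxS
  · rw [mul_div_assoc', div_lt_iff₀ (by positivity)]
    nlinarith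

/-- A square integrable function on a compact set all of whose Fourier coefficients vanish is
zero. -/
theorem ae_eq_zero_of_forall_setIntegral_mul_conj_eq_zero {S : Set G} (hS : IsCompact S) {u : G → ℂ}
    (hu : MemLp u 2 (μ.restrict S))
    (h : ∀ ξ : PontryaginDual G, ∫ x in S, u x * conj (ξ x : ℂ) ∂μ = 0) :
    u =ᵐ[μ.restrict S] 0 := by
  have : IsFiniteMeasure (μ.restrict S) := ⟨by simpa using hS.measure_lt_top⟩
  have htop := topologicalClosure_span_characters_eq_top μ hS
  rw [Submodule.topologicalClosure_eq_top_iff] at htop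
  have hmem : hu.toLp u ∈ ((Submodule.span ℂ (Set.range (characterBCF (G := G)))).map
      (BoundedContinuousFunction.toLp 2 (μ.restrict S) ℂ).toLinearMap)ᗮ := by
    rw [Submodule.map_span, Submodule.mem_orthogonal]
    intro v hv
    induction hv using Submodule.span_induction with
    | mem v hv =>
      obtain ⟨-, ⟨ξ, rfl⟩, rfl⟩ := hv
      rw [L2.inner_def, ← h ξ]
      refine integral_congr_ae ?_
      filter_upwards [hu.coeFn_toLp,
        BoundedContinuousFunction.coeFn_toLp (p := 2) (μ.restrict S) ℂ (characterBCF ξ)]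
        with x hx hx'
      rw [hx]
      -- `toLp` occurs here through a coercion to linear maps, which `rw` does not see through.
      erw [hx']
      exact RCLike.inner_apply _ _
    | zero => exact inner_zero_left _
    | add v w _ _ hv hw => rw [inner_add_left, hv, hw, add_zero]
    | smul a v _ hv => rw [inner_smul_left, hv, mul_zero]
  rw [htop, Submodule.mem_bot] at hmem
  exact (MemLp.toLp_eq_toLp_iff hu MemLp.zero).1 hmem

end Trig

/-! ### Cosets of a compact open subgroup and of its annihilator -/

section Cosets

variable {G : Type*} [CommGroup G]

/-- The coset `q ∈ G ⧸ H`, as a subset of `G`. -/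
def cosetSet (H : Subgroup G) (q : G ⧸ H) : Set G := {x | (x : G ⧸ H) = q}

theorem cosetSet_mk (H : Subgroup G) (y : G) :
    cosetSet H (y : G ⧸ H) = (fun h => y * h) '' (H : Set G) := by
  ext x
  refine ⟨fun hx => ⟨y⁻¹ * x, QuotientGroup.eq.1 (Eq.symm hx), by simp⟩, ?_⟩
  rintro ⟨h, hh, rfl⟩
  exact (QuotientGroup.mk_mul_of_mem y hh)

theorem preimage_mul_left_cosetSet (H : Subgroup G) (q : G ⧸ H) {h : G} (hh : h ∈ H) :
    (fun x => h * x) ⁻¹' cosetSet H q = cosetSet H q := by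
  ext x
  have : ((h * x : G) : G ⧸ H) = x := by rw [mul_comm, QuotientGroup.mk_mul_of_mem x hh]
  change ((h * x : G) : G ⧸ H) = q ↔ (x : G ⧸ H) = q
  rw [this]

variable [TopologicalSpace G] [IsTopologicalGroup G] {H : Subgroup G}

theorem isCompact_cosetSet (hHc : IsCompact (H : Set G)) (q : G ⧸ H) :
    IsCompact (cosetSet H q) := by
  induction q using QuotientGroup.induction_on with
  | H y => rw [cosetSet_mk]; exact hHc.image (continuous_const_mul y)

theorem isOpen_cosetSet (hHo : IsOpen (H : Set G)) (q : G ⧸ H) : IsOpen (cosetSet H q) := by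
  induction q using QuotientGroup.induction_on with
  | H y => rw [cosetSet_mk]; exact isOpenMap_mul_left y _ hHo

theorem isClopen_cosetSet (hHo : IsOpen (H : Set G)) (q : G ⧸ H) : IsClopen (cosetSet H q) := by
  have := QuotientGroup.discreteTopology hHo
  exact (isClopen_discrete {q}).preimage QuotientGroup.continuous_mk

/-- The group is a disjoint union of open compact Hausdorff cosets, so closed sets can be separated
one coset at a time. -/
theorem normalSpace_of_isCompact_of_isOpen [T2Space G] (hHc : IsCompact (H : Set G))
    (hHo : IsOpen (H : Set G)) : NormalSpace G := by
  refine ⟨fun A B hA hB hAB => ?_⟩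
  have h : ∀ q : G ⧸ H, SeparatedNhds (A ∩ cosetSet H q) (B ∩ cosetSet H q) := fun q =>
    .of_isCompact_isCompact ((isCompact_cosetSet hHc q).inter_left hA)
      ((isCompact_cosetSet hHc q).inter_left hB)
      (hAB.mono Set.inter_subset_left Set.inter_subset_left)
  choose U V hU hV hAU hBV hUV using h
  refine ⟨⋃ q, U q ∩ cosetSet H q, ⋃ q, V q ∩ cosetSet H q,
    isOpen_iUnion fun q => (hU q).inter (isOpen_cosetSet hHo q),
    isOpen_iUnion fun q => (hV q).inter (isOpen_cosetSet hHo q),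
    fun x hx => Set.mem_iUnion.2 ⟨x, hAU _ ⟨hx, rfl⟩, rfl⟩,
    fun x hx => Set.mem_iUnion.2 ⟨x, hBV _ ⟨hx, rfl⟩, rfl⟩, ?_⟩
  rw [Set.disjoint_left]
  intro x hx hx'
  obtain ⟨q, hxq, rfl⟩ := Set.mem_iUnion.1 hx
  obtain ⟨r, hxr, rfl⟩ := Set.mem_iUnion.1 hx'
  exact Set.disjoint_left.1 (hUV _) hxq hxr

/-- If translation by `l` preserves `S` and multiplies `f` by a constant `c ≠ 1`, then `f` has
integral zero over `S`. -/
theorem setIntegral_eq_zero_of_mul_left {A : Type*} [Group A] [MeasurableSpace A] [MeasurableMul A]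
    (m : Measure A) [m.IsMulLeftInvariant] {S : Set A} {f : A → ℂ} {l : A} {c : ℂ} (hc : c ≠ 1)
    (hS : (fun a => l * a) ⁻¹' S = S) (hf : ∀ a, f (l * a) = c * f a) : ∫ a in S, f a ∂m = 0 := by
  have h := (measurePreserving_mul_left m l).setIntegral_preimage_emb
    (MeasurableEquiv.mulLeft l).measurableEmbedding f S
  rw [hS] at h
  simp_rw [hf] at h
  rw [integral_const_mul] at h
  have h' : (c - 1) * ∫ a in S, f a ∂m = 0 := by rw [sub_mul, h]; ring
  exact (mul_eq_zero.1 h').resolve_left (sub_ne_zero.2 hc)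

end Cosets

namespace LCA

variable {G : Type*} [CommGroup G] [TopologicalSpace G] {H : Subgroup G}

theorem apply_eq_of_mk_eq {ξ : PontryaginDual G} (hξ : ξ ∈ annihilator H) {x y : G}
    (hxy : (x : G ⧸ H) = y) : ξ x = ξ y := by
  have h := hξ _ (QuotientGroup.eq.1 hxy)
  rw [map_mul, map_inv, inv_mul_eq_one] at h
  exact h

theorem apply_eq_of_annihilator_mk_eq {ξ η : PontryaginDual G}
    (h : (ξ : PontryaginDual G ⧸ annihilator H) = η) {x : G} (hx : x ∈ H) : ξ x = η x := by
  have h1 : (ξ⁻¹ * η) x = 1 := QuotientGroup.eq.1 h x hx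
  have h2 : (ξ x)⁻¹ * η x = 1 := h1
  exact inv_mul_eq_one.1 h2

/-- A character mapping `H` into the open right half circle is trivial on `H`, as the half circle
contains no nontrivial subgroup; for compact `H` these characters form an open set. -/
theorem isOpen_annihilator (hHc : IsCompact (H : Set G)) :
    IsOpen (annihilator H : Set (PontryaginDual G)) := by
  let V : Set (PontryaginDual G) := {ψ | Set.MapsTo ψ H (Circle.centeredArc (Real.pi / 2))}
  have hV : IsOpen V := isOpen_induced (ContinuousMap.isOpen_setOfPred_mapsTo hHc
    (Circle.isOpen_centeredArc (Real.pi / 2)))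
  have h : (annihilator H : Set (PontryaginDual G)) = V := by
    ext ψ
    refine ⟨fun hψ h hh => ?_, fun hψ h hh => ?_⟩
    · rw [hψ h hh, Circle.mem_centeredArc (by linarith [Real.pi_pos])]
      simp [Real.pi_pos]
    · refine Circle.eq_one_of_forall_pow_mem_centeredArc_pi_div_two fun n hn => ?_
      simpa using hψ (pow_mem hh n)
  rw [h]
  exact hV

variable [IsTopologicalGroup G]

/-- The annihilator of `H` is the image of the dual of `G ⧸ H`, which is compact as `G ⧸ H` is
discrete. -/
theorem isCompact_annihilator (hHo : IsOpen (H : Set G)) :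
    IsCompact (annihilator H : Set (PontryaginDual G)) := by
  have := QuotientGroup.discreteTopology hHo
  let π : G →ₜ* G ⧸ H := ⟨QuotientGroup.mk' H, QuotientGroup.continuous_mk⟩
  have h : (annihilator H : Set (PontryaginDual G)) = Set.range (PontryaginDual.map π) := by
    ext ξ
    constructor
    · intro hξ
      have hker : H ≤ (ξ : G →* Circle).ker := fun h hh => hξ h hh
      refine ⟨⟨QuotientGroup.lift H (ξ : G →* Circle) hker, continuous_of_discreteTopology⟩, ?_⟩
      ext x
      rfl
    · rintro ⟨η, rfl⟩ h hh
      rw [PontryaginDual.map_apply]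
      have : π h = 1 := (QuotientGroup.eq_one_iff h).2 hh
      rw [this, map_one]
  rw [h]
  exact isCompact_range (map_continuous _)

/-- The annihilator of `H^⊥` is no larger than `H`: separate points of the discrete group `G ⧸ H`.
-/
theorem exists_mem_annihilator_apply_ne_one (hHo : IsOpen (H : Set G)) {x : G} (hx : x ∉ H) :
    ∃ ξ ∈ annihilator H, ξ x ≠ 1 := by
  have := QuotientGroup.discreteTopology hHo
  let π : G →ₜ* G ⧸ H := ⟨QuotientGroup.mk' H, QuotientGroup.continuous_mk⟩
  have hne : (x : G ⧸ H) ≠ 1 := fun h => hx ((QuotientGroup.eq_one_iff x).1 h)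
  obtain ⟨η, hη⟩ := exists_pontryaginDual_apply_ne_one hne
  refine ⟨PontryaginDual.map π η, fun h hh => ?_, hη⟩
  rw [PontryaginDual.map_apply]
  have : π h = 1 := (QuotientGroup.eq_one_iff h).2 hh
  rw [this, map_one]

theorem setIntegral_cosetSet_conj_eq_zero [MeasurableSpace G] [BorelSpace G] (μ : Measure G)
    [μ.IsMulLeftInvariant] {ξ : PontryaginDual G} (hξ : ξ ∉ annihilator H) (q : G ⧸ H) :
    ∫ x in cosetSet H q, conj (ξ x : ℂ) ∂μ = 0 := by
  have : ∃ h ∈ H, ξ h ≠ 1 := by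
    by_contra! h
    exact hξ h
  obtain ⟨h, hh, hne⟩ := this
  refine setIntegral_eq_zero_of_mul_left μ (c := conj (ξ h : ℂ)) (fun h1 => hne ?_)
    (preimage_mul_left_cosetSet H q hh) fun a => ?_
  · refine Circle.ext ?_
    have := congrArg conj h1
    rwa [Complex.conj_conj, map_one] at this
  · rw [map_mul, Circle.coe_mul, map_mul]

/-- The Fourier transform of the indicator function of a coset of `H^⊥`. -/
theorem setIntegral_annihilator_cosetSet_conj [MeasurableSpace (PontryaginDual G)]
    [BorelSpace (PontryaginDual G)] (ν : Measure (PontryaginDual G)) [ν.IsMulLeftInvariant]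
    (hHo : IsOpen (H : Set G)) (hHc : IsCompact (H : Set G)) (ξ₀ : PontryaginDual G) (x : G)
    [Decidable (x ∈ H)] :
    ∫ ξ in cosetSet (annihilator H) ξ₀, conj (ξ x : ℂ) ∂ν =
      if x ∈ H then ν.real (cosetSet (annihilator H) ξ₀) * conj (ξ₀ x : ℂ) else 0 := by
  split_ifs with hx
  · rw [setIntegral_congr_fun (g := fun _ => conj (ξ₀ x : ℂ))
      (isOpen_cosetSet (isOpen_annihilator hHc) _).measurableSet
      fun ξ hξ => by rw [apply_eq_of_annihilator_mk_eq hξ hx]]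
    rw [setIntegral_const, Complex.real_smul]
  · obtain ⟨η, hη, hne⟩ := exists_mem_annihilator_apply_ne_one hHo hx
    refine setIntegral_eq_zero_of_mul_left ν (c := conj (η x : ℂ)) (fun h1 => hne ?_)
      (preimage_mul_left_cosetSet _ _ hη) fun ξ => ?_
    · refine Circle.ext ?_
      have := congrArg conj h1
      rwa [Complex.conj_conj, map_one] at this
    · change conj ((η x * ξ x : Circle) : ℂ) = _
      rw [Circle.coe_mul, map_mul]

/-- The integral of `ξ(y) conj ξ(x)` over the coset `ξ₀ H^⊥` is, as a function of `x`, supported in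
the coset `y H`. -/
theorem setIntegral_annihilator_cosetSet_mul_conj [MeasurableSpace (PontryaginDual G)]
    [BorelSpace (PontryaginDual G)] (ν : Measure (PontryaginDual G)) [ν.IsMulLeftInvariant]
    (hHc : IsCompact (H : Set G))
    (hHo : IsOpen (H : Set G)) (ξ₀ : PontryaginDual G) (x y : G) :
    ∫ ξ in cosetSet (annihilator H) ξ₀, (ξ y : ℂ) * conj (ξ x : ℂ) ∂ν =
      (cosetSet H (y : G ⧸ H)).indicator (fun x => ν.real (cosetSet (annihilator H) ξ₀) *
        ((ξ₀ y : ℂ) * conj (ξ₀ x : ℂ))) x := by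
  classical
  have h : ∀ ξ : PontryaginDual G, (ξ y : ℂ) * conj (ξ x : ℂ) = conj (ξ (y⁻¹ * x) : ℂ) := by
    intro ξ
    rw [map_mul, map_inv, Circle.coe_mul, Circle.coe_inv_eq_conj, map_mul, Complex.conj_conj]
  simp_rw [h]
  rw [setIntegral_annihilator_cosetSet_conj ν hHo hHc, Set.indicator_apply]
  exact if_congr (by rw [← QuotientGroup.eq]; exact eq_comm) (by rw [h ξ₀]) rfl

end LCA

/-! ### The Fourier transform on cosets of the annihilator -/

namespace LCA

variable {G : Type*} [CommGroup G] [TopologicalSpace G]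

theorem continuous_uncurry_conj_apply [LocallyCompactSpace G] :
    Continuous fun p : PontryaginDual G × G => conj (p.1 p.2 : ℂ) := by
  have h1 : Continuous fun p : PontryaginDual G × G => p.1 p.2 := by
    have h : Continuous fun p : PontryaginDual G × G =>
        (ContinuousMonoidHom.toContinuousMap (p.1 : G →ₜ* Circle)) p.2 :=
      ((ContinuousMonoidHom.isInducing_toContinuousMap G Circle).continuous.comp
        continuous_fst).eval continuous_snd
    exact h
  exact Complex.continuous_conj.comp (continuous_subtype_val.comp h1)

theorem continuous_conj_apply (ξ : PontryaginDual G) : Continuous fun x => conj (ξ x : ℂ) :=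
  Complex.continuous_conj.comp (continuous_coe_character ξ)

theorem norm_conj_apply (ξ : PontryaginDual G) (x : G) : ‖conj (ξ x : ℂ)‖ = 1 := by
  rw [RCLike.norm_conj]
  exact Circle.norm_coe _

theorem continuous_dual_apply (x : G) : Continuous fun ξ : PontryaginDual G => (ξ x : ℂ) := by
  have h : Continuous fun ξ : PontryaginDual G =>
      (ContinuousMonoidHom.toContinuousMap (ξ : G →ₜ* Circle)) x :=
    (continuous_eval_const x).comp
      (ContinuousMonoidHom.isInducing_toContinuousMap G Circle).continuous
  exact continuous_subtype_val.comp h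

variable [MeasurableSpace G] [BorelSpace G] (μ : Measure G)

theorem integrable_mul_conj_apply {g : G → ℂ} (hg : Integrable g μ) (ξ : PontryaginDual G) :
    Integrable (fun x => g x * conj (ξ x : ℂ)) μ :=
  hg.mul_bdd (c := 1) (continuous_conj_apply ξ).aestronglyMeasurable
    (.of_forall fun x => (norm_conj_apply ξ x).le)

theorem norm_fourierL1_sub_le {g φ : G → ℂ} (hg : Integrable g μ) (hφ : Integrable φ μ)
    (ξ : PontryaginDual G) : ‖fourierL1 μ g ξ - fourierL1 μ φ ξ‖ ≤ ∫ x, ‖g x - φ x‖ ∂μ := by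
  rw [fourierL1, fourierL1, ← integral_sub (integrable_mul_conj_apply μ hg ξ)
    (integrable_mul_conj_apply μ hφ ξ)]
  refine (norm_integral_le_integral_norm _).trans_eq (integral_congr_ae (.of_forall fun x => ?_))
  simp only
  rw [← sub_mul, norm_mul, norm_conj_apply, mul_one]

variable [IsTopologicalGroup G] [LocallyCompactSpace G] [μ.IsHaarMeasure]

/-- The Fourier transform of a compactly supported continuous function is continuous, and the
Fourier transform of an integrable function is a uniform limit of such. -/
theorem continuous_fourierL1 [NormalSpace G] [μ.Regular] {g : G → ℂ} (hg : Integrable g μ) :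
    Continuous (fourierL1 μ g) := by
  choose φ hφc hφg hφ hφi using fun n : ℕ =>
    hg.exists_hasCompactSupport_integral_sub_le (Nat.one_div_pos_of_nat (α := ℝ) (n := n))
  have hcont : ∀ n, Continuous (fourierL1 μ (φ n)) := fun n => by
    rw [← continuousOn_univ]
    refine continuousOn_integral_of_compact_support (hφc n)
      (Continuous.continuousOn ?_) fun ξ x _ hx => ?_
    · exact ((hφ n).comp continuous_snd).mul continuous_uncurry_conj_apply
    · rw [image_eq_zero_of_notMem_tsupport hx, zero_mul]
  refine TendstoUniformly.continuous (F := fun n => fourierL1 μ (φ n)) (p := atTop) ?_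
    (.of_forall hcont)
  rw [Metric.tendstoUniformly_iff]
  intro ε hε
  obtain ⟨N, hN⟩ := exists_nat_one_div_lt hε
  filter_upwards [eventually_ge_atTop N] with n hn ξ
  rw [dist_eq_norm]
  exact ((norm_fourierL1_sub_le μ hg (hφi n) ξ).trans (hφg n)).trans_lt
    ((Nat.one_div_le_one_div hn).trans_lt hN)

variable [MeasurableSpace (PontryaginDual G)] [BorelSpace (PontryaginDual G)]
  (ν : Measure (PontryaginDual G)) [ν.IsHaarMeasure] {H : Subgroup G}

/-- The case of `LCA.setIntegral_cosetSet_mul_fourierL1` in which the integrand on the product is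
continuous with compact support. Fubini's theorem then requires neither that the measures
are σ-finite nor that the product σ-algebra contains all Borel sets, either of which may fail. -/
theorem setIntegral_cosetSet_mul_fourierL1_of_hasCompactSupport (hHc : IsCompact (H : Set G))
    (hHo : IsOpen (H : Set G)) (ξ₀ : PontryaginDual G) (y : G) {g : G → ℂ} (hg : Continuous g)
    (hgc : HasCompactSupport g) :
    ∫ ξ in cosetSet (annihilator H) ξ₀, (ξ y : ℂ) * fourierL1 μ g ξ ∂ν =
      ν.real (cosetSet (annihilator H) ξ₀) *
        ((ξ₀ y : ℂ) * ∫ x in cosetSet H (y : G ⧸ H), g x * conj (ξ₀ x : ℂ) ∂μ) := by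
  set C := cosetSet (annihilator H) (ξ₀ : PontryaginDual G ⧸ annihilator H) with hC
  have hCclopen : IsClopen C := isClopen_cosetSet (isOpen_annihilator hHc) _
  have hCc : IsCompact C := isCompact_cosetSet (isCompact_annihilator hHo) _
  have hS : MeasurableSet (cosetSet H (y : G ⧸ H)) := (isOpen_cosetSet hHo _).measurableSet
  -- `C` is clopen, so cutting off outside `C` preserves continuity.
  let k : PontryaginDual G → ℂ := C.indicator fun ξ => (ξ y : ℂ)
  have hk : Continuous k := by
    refine Continuous.indicator (by simp [hCclopen.frontier_eq]) (continuous_dual_apply y)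
  let F : PontryaginDual G → G → ℂ := fun ξ x => g x * (k ξ * conj (ξ x : ℂ))
  have hF : Continuous F.uncurry :=
    (hg.comp continuous_snd).mul ((hk.comp continuous_fst).mul continuous_uncurry_conj_apply)
  have hFc : HasCompactSupport F.uncurry := by
    refine HasCompactSupport.intro (hCc.prod hgc) fun p hp => ?_
    change g p.2 * (k p.1 * conj (p.1 p.2 : ℂ)) = 0
    by_cases h1 : p.1 ∈ C
    · have : p.2 ∉ tsupport g := fun h2 => hp ⟨h1, h2⟩
      rw [image_eq_zero_of_notMem_tsupport this, zero_mul]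
    · simp [k, h1]
  have hswap := integral_integral_swap_of_hasCompactSupport hF hFc (μ := ν) (ν := μ)
  calc ∫ ξ in C, (ξ y : ℂ) * fourierL1 μ g ξ ∂ν = ∫ ξ, ∫ x, F ξ x ∂μ ∂ν := by
        rw [← integral_indicator hCclopen.isOpen.measurableSet]
        refine integral_congr_ae (.of_forall fun ξ => ?_)
        change C.indicator (fun ξ => (ξ y : ℂ) * fourierL1 μ g ξ) ξ =
          ∫ x, g x * (k ξ * conj (ξ x : ℂ)) ∂μ
        have : ∀ x, g x * (k ξ * conj (ξ x : ℂ)) = k ξ * (g x * conj (ξ x : ℂ)) := fun x => by ring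
        simp_rw [this]
        rw [integral_const_mul]
        exact Set.indicator_mul_left C _ _
    _ = ∫ x, ∫ ξ, F ξ x ∂ν ∂μ := hswap
    _ = ∫ x, (cosetSet H (y : G ⧸ H)).indicator
          (fun x => ν.real C * (ξ₀ y : ℂ) * (g x * conj (ξ₀ x : ℂ))) x ∂μ := by
        refine integral_congr_ae (.of_forall fun x => ?_)
        change ∫ ξ, g x * (k ξ * conj (ξ x : ℂ)) ∂ν = _
        rw [integral_const_mul]
        have : ∀ ξ, k ξ * conj (ξ x : ℂ) = C.indicator (fun ξ => (ξ y : ℂ) * conj (ξ x : ℂ)) ξ :=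
          fun ξ => (Set.indicator_mul_left C (fun ξ => (ξ y : ℂ)) fun ξ => conj (ξ x : ℂ)).symm
        simp_rw [this]
        rw [integral_indicator hCclopen.isOpen.measurableSet,
          setIntegral_annihilator_cosetSet_mul_conj ν hHc hHo]
        by_cases hx : x ∈ cosetSet H (y : G ⧸ H)
        · simp only [Set.indicator_of_mem hx]
          ring
        · simp only [Set.indicator_of_notMem hx, mul_zero]
    _ = _ := by rw [integral_indicator hS, integral_const_mul, mul_assoc]

/-- The Fourier transform of an integrable `g` on the coset `ξ₀ H^⊥` determines the integral of
`g * conj ξ₀` on every coset of `H`: a case of the multiplication formula. -/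
theorem setIntegral_cosetSet_mul_fourierL1 [NormalSpace G] [μ.Regular] (hHc : IsCompact (H : Set G))
    (hHo : IsOpen (H : Set G)) (ξ₀ : PontryaginDual G) (y : G) {g : G → ℂ} (hg : Integrable g μ) :
    ∫ ξ in cosetSet (annihilator H) ξ₀, (ξ y : ℂ) * fourierL1 μ g ξ ∂ν =
      ν.real (cosetSet (annihilator H) ξ₀) *
        ((ξ₀ y : ℂ) * ∫ x in cosetSet H (y : G ⧸ H), g x * conj (ξ₀ x : ℂ) ∂μ) := by
  set C := cosetSet (annihilator H) (ξ₀ : PontryaginDual G ⧸ annihilator H) with hC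
  have hCc : IsCompact C := isCompact_cosetSet (isCompact_annihilator hHo) _
  have hint : ∀ φ : G → ℂ, Integrable φ μ →
      IntegrableOn (fun ξ => (ξ y : ℂ) * fourierL1 μ φ ξ) C ν := fun φ hφ => by
    exact ((continuous_dual_apply y).mul (continuous_fourierL1 μ hφ)).continuousOn
      |>.integrableOn_compact hCc
  refine eq_of_forall_dist_le fun ε hε => ?_
  obtain ⟨φ, hφc, hφg, hφ, hφi⟩ := hg.exists_hasCompactSupport_integral_sub_le
    (ε := ε / (2 * (ν.real C + 1))) (by positivity)
  have key := setIntegral_cosetSet_mul_fourierL1_of_hasCompactSupport μ ν hHc hHo ξ₀ y hφ hφc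
  rw [← hC] at key
  have h1 : ‖∫ ξ in C, (ξ y : ℂ) * fourierL1 μ g ξ ∂ν -
      ∫ ξ in C, (ξ y : ℂ) * fourierL1 μ φ ξ ∂ν‖ ≤ ε / (2 * (ν.real C + 1)) * ν.real C := by
    rw [← integral_sub (hint g hg) (hint φ hφi)]
    refine norm_setIntegral_le_of_norm_le_const hCc.measure_lt_top fun ξ _ => ?_
    rw [← mul_sub, norm_mul, Circle.norm_coe, one_mul]
    exact (norm_fourierL1_sub_le μ hg hφi ξ).trans hφg
  have h2 : ‖∫ x in cosetSet H (y : G ⧸ H), g x * conj (ξ₀ x : ℂ) ∂μ -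
      ∫ x in cosetSet H (y : G ⧸ H), φ x * conj (ξ₀ x : ℂ) ∂μ‖ ≤ ε / (2 * (ν.real C + 1)) := by
    rw [← integral_sub (integrable_mul_conj_apply μ hg ξ₀).integrableOn
      (integrable_mul_conj_apply μ hφi ξ₀).integrableOn]
    refine ((norm_integral_le_integral_norm _).trans (?_ : _ ≤ ∫ x, ‖g x - φ x‖ ∂μ)).trans hφg
    refine le_trans (le_of_eq ?_) (setIntegral_le_integral (s := cosetSet H (y : G ⧸ H))
      (hg.sub hφi).norm (.of_forall fun x => norm_nonneg _))
    refine integral_congr_ae (.of_forall fun x => ?_)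
    beta_reduce
    rw [← sub_mul, norm_mul, norm_conj_apply, mul_one]
  have hν : 0 ≤ ν.real C := measureReal_nonneg
  have hbound : ν.real C * (ε / (2 * (ν.real C + 1))) ≤ ε / 2 := by
    rw [mul_div_assoc', div_le_div_iff₀ (by positivity) two_pos]
    nlinarith
  rw [dist_eq_norm]
  have h3 : ∀ a b c d : ℂ, ∀ r : ℝ, a - r * ((ξ₀ y : ℂ) * c) =
      (a - b) + (b - r * ((ξ₀ y : ℂ) * d)) - r * ((ξ₀ y : ℂ) * (c - d)) := by
    intros; ring
  rw [h3 _ (∫ ξ in C, (ξ y : ℂ) * fourierL1 μ φ ξ ∂ν) _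
    (∫ x in cosetSet H (y : G ⧸ H), φ x * conj (ξ₀ x : ℂ) ∂μ), sub_eq_zero.2 key, add_zero]
  refine (norm_sub_le _ _).trans ?_
  rw [norm_mul, norm_mul, Circle.norm_coe, one_mul, Complex.norm_real, Real.norm_of_nonneg hν]
  nlinarith [mul_le_mul_of_nonneg_left h2 hν]

end LCA

/-! ### Paley-Wiener functions of the annihilator -/

/-- Convergence in `L²` implies convergence of integrals over sets of finite measure, against a
weight of modulus `1`. -/
theorem tendsto_setIntegral_mul_of_eLpNorm_two {α : Type*} [MeasurableSpace α] {m : Measure α}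
    {S : Set α} (hS : m S ≠ ∞) {u : ℕ → α → ℂ} {v w : α → ℂ} (hu : ∀ n, IntegrableOn (u n) S m)
    (hv : IntegrableOn v S m)
    (h : Tendsto (fun n => eLpNorm (fun x => u n x - v x) 2 m) atTop (𝓝 0))
    (hw : AEStronglyMeasurable w (m.restrict S)) (hw1 : ∀ x, ‖w x‖ = 1) :
    Tendsto (fun n => ∫ x in S, w x * u n x ∂m) atTop (𝓝 (∫ x in S, w x * v x ∂m)) := by
  have hb : ∀ᵐ x ∂m.restrict S, ‖w x‖ ≤ 1 := .of_forall fun x => (hw1 x).le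
  refine tendsto_integral_of_L1' (fun x => w x * v x) (hv.bdd_mul hw hb).aestronglyMeasurable
    (.of_forall fun n => (hu n).bdd_mul hw hb) ?_
  set c : ℝ≥0∞ := (m.restrict S) Set.univ ^
    (1 / (1 : ℝ≥0∞).toReal - 1 / (2 : ℝ≥0∞).toReal) with hc
  have hctop : c ≠ ∞ := by
    refine ENNReal.rpow_ne_top_of_nonneg (by norm_num) ?_
    rwa [Measure.restrict_apply_univ]
  have hlim : Tendsto (fun n => eLpNorm (fun x => u n x - v x) 2 m * c) atTop (𝓝 0) := by
    simpa using ENNReal.Tendsto.mul_const h (Or.inr hctop)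
  refine tendsto_of_tendsto_of_tendsto_of_le_of_le tendsto_const_nhds hlim
    (fun _ => zero_le) fun n => ?_
  calc eLpNorm ((fun x => w x * u n x) - fun x => w x * v x) 1 (m.restrict S)
      = eLpNorm (fun x => u n x - v x) 1 (m.restrict S) := by
        refine eLpNorm_congr_norm_ae (.of_forall fun x => ?_)
        simp only [Pi.sub_apply]
        rw [← mul_sub, norm_mul, hw1, one_mul]
    _ ≤ eLpNorm (fun x => u n x - v x) 2 (m.restrict S) * c :=
        eLpNorm_le_eLpNorm_mul_rpow_measure_univ one_le_two
          ((hu n).aestronglyMeasurable.sub hv.aestronglyMeasurable)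
    _ ≤ eLpNorm (fun x => u n x - v x) 2 m * c := by
        gcongr
        exact Measure.restrict_le_self

theorem MeasureTheory.MemLp.integrableOn_of_measure_ne_top {α : Type*} [MeasurableSpace α]
    {m : Measure α} {S : Set α} (hS : m S ≠ ∞) {v : α → ℂ} (hv : MemLp v 2 m) :
    IntegrableOn v S m := by
  have : IsFiniteMeasure (m.restrict S) := ⟨by rw [Measure.restrict_apply_univ]; exact hS.lt_top⟩
  exact (hv.restrict S).integrable one_le_two

/-- A square integrable function on `G` vanishes, at every point, off countably many cosets of an
open subgroup. -/
theorem exists_countable_cosets_of_memLp {G : Type*} [CommGroup G] [TopologicalSpace G]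
    [IsTopologicalGroup G] [MeasurableSpace G] [BorelSpace G] {μ : Measure G} [μ.IsOpenPosMeasure]
    [μ.OuterRegular] {H : Subgroup G} (hHo : IsOpen (H : Set G)) {f : G → ℂ} (hf : MemLp f 2 μ) :
    ∃ D : Set (G ⧸ H), D.Countable ∧ ∀ x, f x ≠ 0 → (x : G ⧸ H) ∈ D := by
  -- Each `{|f| ≥ 1 / (n + 1)}` lies in an open set of finite measure, which meets each coset in an
  -- open set and so can meet only countably many.
  have hfin : ∀ n : ℕ, μ {x | (1 / (n + 1) : NNReal) ≤ ‖f x‖₊} < ∞ := fun n =>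
    hf.meas_ge_lt_top (by simp) (by simp) (one_div_ne_zero n.cast_add_one_ne_zero)
  choose U hU hUo hUfin using fun n => Set.exists_isOpen_lt_of_lt _ _ (hfin n)
  have hopen : ∀ n q, IsOpen (U n ∩ cosetSet H q) := fun n q =>
    (hUo n).inter (isOpen_cosetSet hHo q)
  refine ⟨⋃ n, {q | 0 < μ (U n ∩ cosetSet H q)}, Set.countable_iUnion fun n => ?_, fun x hx => ?_⟩
  · refine Measure.countable_meas_pos_of_disjoint_of_meas_iUnion_ne_top μ
      (fun q => (hopen n q).measurableSet) (fun q r hqr => ?_) ?_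
    · refine Set.disjoint_left.2 fun x hx hx' => hqr ?_
      exact hx.2.symm.trans hx'.2
    · exact ((measure_mono (Set.iUnion_subset fun q => Set.inter_subset_left)).trans_lt
        (hUfin n)).ne
  · obtain ⟨n, hn⟩ := exists_nat_one_div_lt (norm_pos_iff.2 hx)
    refine Set.mem_iUnion.2 ⟨n, (hopen n _).measure_pos μ ⟨x, hU n ?_, rfl⟩⟩
    have : (1 / (n + 1) : NNReal) ≤ ‖f x‖₊ := by
      rw [← NNReal.coe_le_coe]
      push_cast
      exact hn.le
    exact this

theorem continuous_average_cosetSet {G : Type*} [CommGroup G] [TopologicalSpace G]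
    [IsTopologicalGroup G] [MeasurableSpace G] (μ : Measure G) {H : Subgroup G}
    (hHo : IsOpen (H : Set G)) (f : G → ℂ) :
    Continuous fun x : G => ⨍ z in cosetSet H (x : G ⧸ H), f z ∂μ := by
  have := QuotientGroup.discreteTopology hHo
  exact (continuous_of_discreteTopology (f := fun q : G ⧸ H => ⨍ z in cosetSet H q, f z ∂μ)).comp
    QuotientGroup.continuous_mk

namespace LCA

section

variable {G : Type*} [CommGroup G] [TopologicalSpace G] [IsTopologicalGroup G]
  [LocallyCompactSpace G] [T2Space G] [MeasurableSpace G] [BorelSpace G]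
  [MeasurableSpace (PontryaginDual G)] [BorelSpace (PontryaginDual G)]
  {μ : Measure G} [μ.IsHaarMeasure] {ν : Measure (PontryaginDual G)} [ν.IsHaarMeasure]
  {H : Subgroup G}

/-- The multiplication formula on the coset `ξ₀ H^⊥`, where the Fourier transform of `f` vanishes,
passed to the limit along a sequence in `L¹ ∩ L²` that defines the Fourier transform of `f`. -/
theorem setIntegral_mul_conj_eq_zero_of_mem_paleyWiener [μ.Regular] (hHc : IsCompact (H : Set G))
    (hHo : IsOpen (H : Set G)) {f : Lp ℂ 2 μ}
    (hf : f ∈ paleyWiener μ ν (annihilator H : Set (PontryaginDual G))) {ξ₀ : PontryaginDual G}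
    (hξ₀ : ξ₀ ∉ annihilator H) (q : G ⧸ H) :
    ∫ x in cosetSet H q, f x * conj (ξ₀ x : ℂ) ∂μ = 0 := by
  have := normalSpace_of_isCompact_of_isOpen hHc hHo
  induction q using QuotientGroup.induction_on with
  | H y =>
  obtain ⟨F, ⟨g, hg, hgf, hgF⟩, hF⟩ := hf
  set C := cosetSet (annihilator H) (ξ₀ : PontryaginDual G ⧸ annihilator H) with hC
  have hCc : IsCompact C := isCompact_cosetSet (isCompact_annihilator hHo) _
  have hCo : IsOpen C := isOpen_cosetSet (isOpen_annihilator hHc) _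
  have hSc := isCompact_cosetSet hHc (y : G ⧸ H)
  have hCpos : 0 < ν.real C :=
    ENNReal.toReal_pos (hCo.measure_pos ν ⟨ξ₀, rfl⟩).ne' hCc.measure_lt_top.ne
  have h1 := tendsto_setIntegral_mul_of_eLpNorm_two (S := C) (w := fun ξ => (ξ y : ℂ))
    hCc.measure_lt_top.ne
    (fun n => (continuous_fourierL1 μ (hg n).1).continuousOn.integrableOn_compact hCc)
    ((Lp.memLp F).integrableOn_of_measure_ne_top hCc.measure_lt_top.ne) hgF
    (continuous_dual_apply y).aestronglyMeasurable fun ξ => Circle.norm_coe _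
  have h2 := tendsto_setIntegral_mul_of_eLpNorm_two (S := cosetSet H (y : G ⧸ H))
    (w := fun x => conj (ξ₀ x : ℂ)) hSc.measure_lt_top.ne (fun n => (hg n).1.integrableOn)
    ((Lp.memLp f).integrableOn_of_measure_ne_top hSc.measure_lt_top.ne) hgf
    (continuous_conj_apply ξ₀).aestronglyMeasurable (norm_conj_apply ξ₀)
  have h3 : ∫ ξ in C, (ξ y : ℂ) * F ξ ∂ν = 0 := by
    refine integral_eq_zero_of_ae ?_
    filter_upwards [ae_restrict_of_ae hF, ae_restrict_mem hCo.measurableSet] with ξ hξ hξC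
    rw [hξ fun hmem => hξ₀ ?_, mul_zero]
    · rfl
    · have h4 : ξ⁻¹ * ξ₀ ∈ annihilator H := QuotientGroup.eq.1 hξC
      simpa using mul_mem hmem h4
  rw [h3] at h1
  simp_rw [hC, setIntegral_cosetSet_mul_fourierL1 μ ν hHc hHo ξ₀ y (hg _).1] at h1
  simp_rw [mul_comm (conj (ξ₀ _ : ℂ))] at h2
  have h5 := tendsto_nhds_unique h1 ((h2.const_mul (ξ₀ y : ℂ)).const_mul (ν.real C : ℂ))
  have h6 : (ν.real C : ℂ) ≠ 0 := Complex.ofReal_ne_zero.2 hCpos.ne'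
  exact ((mul_eq_zero.1 ((mul_eq_zero.1 h5.symm).resolve_left h6))).resolve_left
    (Circle.coe_ne_zero _)

theorem ae_eq_average_of_mem_paleyWiener [μ.Regular] (hHc : IsCompact (H : Set G))
    (hHo : IsOpen (H : Set G)) {f : Lp ℂ 2 μ}
    (hf : f ∈ paleyWiener μ ν (annihilator H : Set (PontryaginDual G))) (q : G ⧸ H) :
    ∀ᵐ x ∂μ.restrict (cosetSet H q), f x = ⨍ z in cosetSet H q, f z ∂μ := by
  have := normalSpace_of_isCompact_of_isOpen hHc hHo
  have hSc := isCompact_cosetSet hHc q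
  have hfin : IsFiniteMeasure (μ.restrict (cosetSet H q)) :=
    ⟨by rw [Measure.restrict_apply_univ]; exact hSc.measure_lt_top⟩
  have hfi : IntegrableOn f (cosetSet H q) μ :=
    (Lp.memLp f).integrableOn_of_measure_ne_top hSc.measure_lt_top.ne
  set c : ℂ := ⨍ z in cosetSet H q, f z ∂μ with hc
  have h := ae_eq_zero_of_forall_setIntegral_mul_conj_eq_zero μ hSc
    (u := fun x => f x - c) (((Lp.memLp f).restrict _).sub (memLp_const c)) fun ξ => ?_
  · filter_upwards [h] with x hx using sub_eq_zero.1 hx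
  -- Characters in `H^⊥` are constant on the coset, and `f - c` has mean zero there; the others are
  -- orthogonal both to `f` and to constants.
  by_cases hξ : ξ ∈ annihilator H
  · obtain ⟨y, rfl⟩ := QuotientGroup.mk_surjective q
    rw [setIntegral_congr_fun (g := fun x => (f x - c) * conj (ξ y : ℂ)) hSc.measurableSet
      fun x hx => by rw [apply_eq_of_mk_eq hξ hx]]
    rw [integral_mul_const, hc, integral_sub_average, zero_mul]
  · simp_rw [sub_mul]
    rw [integral_sub (hfi.mul_bdd (c := 1) (continuous_conj_apply ξ).aestronglyMeasurable
        (.of_forall fun x => (norm_conj_apply ξ x).le))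
      (((continuous_conj_apply ξ).const_mul c).continuousOn.integrableOn_compact hSc),
      setIntegral_mul_conj_eq_zero_of_mem_paleyWiener hHc hHo hf hξ, integral_const_mul,
      setIntegral_cosetSet_conj_eq_zero μ hξ, mul_zero, sub_zero]

/-- An element of the Paley-Wiener space of `H^⊥` agrees almost everywhere with its averages over
the cosets of `H`. -/
theorem average_ae_eq_of_mem_paleyWiener [μ.Regular] (hHc : IsCompact (H : Set G))
    (hHo : IsOpen (H : Set G)) {f : Lp ℂ 2 μ}
    (hf : f ∈ paleyWiener μ ν (annihilator H : Set (PontryaginDual G))) :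
    (fun x : G => ⨍ z in cosetSet H (x : G ⧸ H), f z ∂μ) =ᵐ[μ] f := by
  obtain ⟨D, hD, hfD⟩ := exists_countable_cosets_of_memLp hHo (Lp.memLp f)
  have h : ∀ᵐ x ∂μ, ∀ q ∈ D, x ∈ cosetSet H q → f x = ⨍ z in cosetSet H q, f z ∂μ :=
    (ae_ball_iff hD).2 fun q _ => (ae_restrict_iff' (isOpen_cosetSet hHo q).measurableSet).1
      (ae_eq_average_of_mem_paleyWiener hHc hHo hf q)
  filter_upwards [h] with x hx
  by_cases hxD : (x : G ⧸ H) ∈ D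
  · exact (hx _ hxD rfl).symm
  · have h0 : ∀ z ∈ cosetSet H (x : G ⧸ H), f z = 0 := fun z hz => by
      by_contra hne
      exact hxD ((show (z : G ⧸ H) = x from hz) ▸ hfD z hne)
    rw [h0 x rfl, setAverage_eq,
      setIntegral_eq_zero_of_forall_eq_zero h0, smul_zero]

/-- The Fourier transform of the indicator function of a coset of `H` is continuous and vanishes off
the compact set `H^⊥`, by orthogonality of characters, hence is square integrable. -/
theorem indicator_cosetSet_mem_paleyWienerFun [μ.Regular] (hHc : IsCompact (H : Set G))
    (hHo : IsOpen (H : Set G)) (q : G ⧸ H) :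
    (cosetSet H q).indicator (fun _ => (1 : ℂ)) ∈
      paleyWienerFun μ ν (annihilator H : Set (PontryaginDual G)) := by
  have := normalSpace_of_isCompact_of_isOpen hHc hHo
  have hSc := isCompact_cosetSet hHc q
  have hSo := isClopen_cosetSet hHo q
  set g : G → ℂ := (cosetSet H q).indicator fun _ => 1 with hg
  have hgi : Integrable g μ :=
    (integrable_indicator_iff hSc.measurableSet).2 (integrableOn_const hSc.measure_lt_top.ne)
  have hgm : MemLp g 2 μ := memLp_indicator_const 2 hSc.measurableSet 1
    (Or.inr hSc.measure_lt_top.ne)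
  have hoff : ∀ ξ ∉ annihilator H, fourierL1 μ g ξ = 0 := fun ξ hξ => by
    rw [← setIntegral_cosetSet_conj_eq_zero μ hξ q, ← integral_indicator hSc.measurableSet]
    refine integral_congr_ae (.of_forall fun x => ?_)
    change g x * conj (ξ x : ℂ) = (cosetSet H q).indicator (fun x => conj (ξ x : ℂ)) x
    by_cases hx : x ∈ cosetSet H q <;> simp [hg, hx]
  have hFm : MemLp (fourierL1 μ g) 2 ν :=
    (continuous_fourierL1 μ hgi).memLp_of_hasCompactSupport
      (HasCompactSupport.intro (isCompact_annihilator hHo) hoff)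
  refine ⟨continuous_const.indicator (by simp [hSo.frontier_eq]), hgm.toLp g,
    ⟨hFm.toLp _, ⟨fun _ => g, fun _ => ⟨hgi, hgm⟩, ?_, ?_⟩, ?_⟩, hgm.coeFn_toLp.symm⟩
  · have : eLpNorm (fun x => g x - hgm.toLp g x) 2 μ = 0 := by
      rw [eLpNorm_congr_ae (g := 0), eLpNorm_zero]
      filter_upwards [hgm.coeFn_toLp] with x hx
      rw [hx, sub_self]; rfl
    simp [this]
  · have : eLpNorm (fun ξ => fourierL1 μ g ξ - hFm.toLp _ ξ) 2 ν = 0 := by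
      rw [eLpNorm_congr_ae (g := 0), eLpNorm_zero]
      filter_upwards [hFm.coeFn_toLp] with x hx
      rw [hx, sub_self]; rfl
    simp [this]
  · filter_upwards [hFm.coeFn_toLp] with ξ hξ hmem
    rw [hξ]
    exact hoff ξ hmem

end

/-- Any choice of one point from each coset of an open subgroup is a section: it is closed, hence
measurable. -/
theorem isSection_range {G : Type*} [CommGroup G] [TopologicalSpace G] [IsTopologicalGroup G]
    [T2Space G] [MeasurableSpace G] [BorelSpace G] {H : Subgroup G} (hHo : IsOpen (H : Set G))
    {s : G ⧸ H → G} (hs : ∀ q, (s q : G ⧸ H) = q) : IsSection H (Set.range s) := by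
  constructor
  · have h : (Set.range s)ᶜ = ⋃ q, cosetSet H q \ {s q} := by
      ext x
      simp only [Set.mem_compl_iff, Set.mem_range, not_exists, Set.mem_iUnion]
      refine ⟨fun hx => ⟨x, rfl, fun h => hx _ (Eq.symm h)⟩, ?_⟩
      rintro ⟨q, hxq, hne⟩ r rfl
      have : r = q := (hs r).symm.trans hxq
      exact hne (congrArg s this)
    have hopen : IsOpen (Set.range s)ᶜ := by
      rw [h]
      exact isOpen_iUnion fun q => (isOpen_cosetSet hHo q).sdiff isClosed_singleton
    exact (isOpen_compl_iff.1 hopen).measurableSet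
  · refine fun q => ⟨s q, ⟨⟨q, rfl⟩, hs q⟩, ?_⟩
    rintro - ⟨⟨r, rfl⟩, hr⟩
    exact congrArg s ((hs r).symm.trans hr)

end LCA

theorem mainTheorem6 {G : Type*} [CommGroup G] [TopologicalSpace G] [IsTopologicalGroup G]
    [LocallyCompactSpace G] [T2Space G] [MeasurableSpace G] [BorelSpace G]
    [MeasurableSpace (PontryaginDual G)] [BorelSpace (PontryaginDual G)]
    (μ : Measure G) [μ.IsHaarMeasure] [μ.Regular]
    (ν : Measure (PontryaginDual G)) [ν.IsHaarMeasure] [ν.Regular]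
    (H : Subgroup G) (hHc : IsCompact (H : Set G)) (hHo : IsOpen (H : Set G)) :
    (∀ f ∈ LCA.paleyWiener μ ν (LCA.annihilator H : Set (PontryaginDual G)),
      ∃! g : G → ℂ, Continuous g ∧ g =ᵐ[μ] f) ∧
    ∀ Υ : Set G,
      LCA.IsUniquenessSet
          (LCA.paleyWienerFun μ ν (LCA.annihilator H : Set (PontryaginDual G))) Υ ↔
        ∃ C : Set G, LCA.IsSection H C ∧ C ⊆ Υ := by
  refine ⟨fun f hf => ⟨_, ⟨continuous_average_cosetSet μ hHo f,
    LCA.average_ae_eq_of_mem_paleyWiener hHc hHo hf⟩, fun g hg => ?_⟩, fun Υ => ⟨fun hΥ => ?_, ?_⟩⟩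
  · exact (hg.1.ae_eq_iff_eq μ (continuous_average_cosetSet μ hHo f)).1
      (hg.2.trans (LCA.average_ae_eq_of_mem_paleyWiener hHc hHo hf).symm)
  · have h : ∀ q : G ⧸ H, ∃ x : G, x ∈ Υ ∧ (x : G ⧸ H) = q := by
      intro q
      by_contra! hq
      have h0 := hΥ _ (LCA.indicator_cosetSet_mem_paleyWienerFun hHc hHo q)
        fun υ hυ => Set.indicator_of_notMem (s := cosetSet H q) (hq υ hυ) _
      obtain ⟨y, rfl⟩ := QuotientGroup.mk_surjective q
      have h1 := congrFun h0 y
      rw [Set.indicator_of_mem (show y ∈ cosetSet H (y : G ⧸ H) from rfl)] at h1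
      exact one_ne_zero h1
    choose s hsΥ hs using h
    exact ⟨Set.range s, LCA.isSection_range hHo hs, Set.range_subset_iff.2 hsΥ⟩
  · rintro ⟨C, ⟨-, hC⟩, hCΥ⟩ g ⟨hgc, f, hf, hgf⟩ hg0
    have hg : g = fun x : G => ⨍ z in cosetSet H (x : G ⧸ H), f z ∂μ :=
      (hgc.ae_eq_iff_eq μ (continuous_average_cosetSet μ hHo f)).1
        (hgf.trans (LCA.average_ae_eq_of_mem_paleyWiener hHc hHo hf).symm)
    ext x
    obtain ⟨c, ⟨hcC, hcx⟩, -⟩ := hC x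
    have h1 : g x = g c := by
      rw [hg]
      simp only [hcx]
    rw [h1, hg0 c (hCΥ hcC)]
    rfl
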